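/- A probabilistic pushdown automaton (pPDA) has finite sets $Q$ (control states) and $\Gamma$ (stack letters) and finitely many transitions $pX\to q\alpha$ with $p,q\in Q$, $X\in\Gamma$, $\alpha\in\Gamma^*$, $|\alpha|\le 2$, each with a probability in $(0,1]$, such that for all $p,X$ the probabilities of the transitions $pX\to q\alpha$ sum to $1$. It is strict if for all $p,q\in Q$ and $X\in\Gamma$ there is a transition $pX\to q\varepsilon$. Its termination system $\mathbf X=\mathbf f(\mathbf X)$ has the $n=|Q|^2|\Gamma|$ variables $[pXq]$ and the equations $$[pXq]=\sum_{pX\xrightarrow{x}rYZ}x\sum_{t\in Q}[rYt][tZq]+\sum_{pX\xrightarrow{x}rY}x\,[rYq]+\sum_{pX\xrightarrow{x}q\varepsilon}x .$$ The system is strongly connected if for any two variables $X_i,X_k$ the pair $(i,k)$ lies in the reflexive transitive closure of the relation "$\partial f_i/\partial X_k$ is not the zero polynomial". **Proposition 4.3.** Let $\mathbf f$ be the termination system of a strict pPDA, strongly connected, with $n$ variables and with coefficients that are ratios of $m$-bit natural numbers (numbers $<2^m$). Then $\mathbf f$ has a least non-negative fixed point $\mu$, all components of $\mu$ are positive, and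 for $$k_{\mathbf f}=n\cdot\log_2\frac{\mu_{\max}}{c_{\min}\cdot\mu_{\min}\cdot\min\{\mu_{\min},1\}},$$ where $\mu_{\min},\mu_{\max}$ are the minimal and maximal components of $\mu$ and $c_{\min}$ is the smallest non-zero coefficient of $\mathbf f$ (for $n=0$, $k_{\mathbf f}=0$), we have $$k_{\mathbf f}\le 3nm .$$ Here $k_{\mathbf f}$ is a convergence threshold of Newton's method: the sequence $\nu^{(0)}=0$, $\nu^{(k+1)}=\nu^{(k)}+(\mathrm{Id}-\mathbf f'(\nu^{(k)}))^{-1}(\mathbf f(\nu^{(k)})-\nu^{(k)})$ is well-defined (all inverses exist), and for every $i\in\mathbb N$ the iterate $\nu^{(\lceil k_{\mathbf f}\rceil+i)}$ has $i$ valid bits of $\mu$, i.e. $|\mu_j-\nu^{(\lceil k_{\mathbf f}\rceil+i)}_j|/|\mu_j|\le 2^{-i}$ for all $j$. -/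

import Mathlib

/-! ### Systems of polynomials, least fixed points, Newton's method -/

/-- A system of real polynomials, with variables and equations indexed by `σ`. -/
abbrev PolySystem (σ : Type*) := σ → MvPolynomial σ ℝ

namespace PolySystem

variable {σ : Type*}

/-- The value `f(x)` of the system at the point `x`. -/
noncomputable def value (f : PolySystem σ) (x : σ → ℝ) : σ → ℝ :=
  fun i => MvPolynomial.eval x (f i)

/-- `μ` is the least fixed point of `f` among the non-negative vectors (componentwise order). -/
def IsLeastFixedPoint (f : PolySystem σ) (μ : σ → ℝ) : Prop :=
  IsLeast {x : σ → ℝ | 0 ≤ x ∧ f.value x = x} μ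

/-- `X_i` depends directly on `X_k`: the polynomial `∂f_i/∂X_k` is not zero. -/
def DependsDirectly (f : PolySystem σ) (i k : σ) : Prop :=
  MvPolynomial.pderiv k (f i) ≠ 0

/-- All variables depend on each other, dependence being the reflexive transitive closure
of direct dependence. -/
def StronglyConnected (f : PolySystem σ) : Prop :=
  ∀ i k : σ, Relation.ReflTransGen f.DependsDirectly i k

/-- Every non-zero coefficient of `f` is a ratio of two `m`-bit numbers. -/
def HasBitCoeffs (f : PolySystem σ) (m : ℕ) : Prop :=
  ∀ (i : σ) (d : σ →₀ ℕ), (f i).coeff d ≠ 0 →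
    ∃ a b : ℕ, a < 2 ^ m ∧ 0 < b ∧ b < 2 ^ m ∧ (f i).coeff d = (a : ℝ) / (b : ℝ)

/-- The smallest non-zero coefficient of `f`. -/
noncomputable def cmin (f : PolySystem σ) : ℝ :=
  sInf {c : ℝ | c ≠ 0 ∧ ∃ (i : σ) (d : σ →₀ ℕ), (f i).coeff d = c}

/-- The threshold `k_f = n · log₂ (μ_max / (c_min · μ_min · min {μ_min, 1}))`, where `n` is the
number of variables and `μ_min`, `μ_max` are the minimal and maximal components of `μ`. -/
noncomputable def threshold [Fintype σ] (f : PolySystem σ) (μ : σ → ℝ) : ℝ :=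
  (Fintype.card σ : ℝ) *
    Real.logb 2 ((⨆ i, μ i) / (f.cmin * (⨅ i, μ i) * min (⨅ i, μ i) 1))

/-- The Jacobian matrix `f'(x)`. -/
noncomputable def jacobian (f : PolySystem σ) (x : σ → ℝ) : Matrix σ σ ℝ :=
  Matrix.of fun i j => MvPolynomial.eval x (MvPolynomial.pderiv j (f i))

/-- The Newton sequence `ν⁽⁰⁾ = 0`, `ν⁽ᵏ⁺¹⁾ = ν⁽ᵏ⁾ + (Id - f'(ν⁽ᵏ⁾))⁻¹ (f(ν⁽ᵏ⁾) - ν⁽ᵏ⁾)`.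
The matrix inverse is meaningful only where `Id - f'(ν⁽ᵏ⁾)` is invertible. -/
noncomputable def newton [Fintype σ] [DecidableEq σ] (f : PolySystem σ) : ℕ → σ → ℝ
  | 0 => 0
  | k + 1 => newton f k +
      (1 - f.jacobian (newton f k))⁻¹.mulVec (f.value (newton f k) - newton f k)

/-- The Newton sequence of `f` is well-defined: all the matrices to be inverted are invertible. -/
def NewtonDefined [Fintype σ] [DecidableEq σ] (f : PolySystem σ) : Prop :=
  ∀ k : ℕ, IsUnit (1 - f.jacobian (f.newton k))

end PolySystem

/-- The vector `ν` has `i` valid bits of `μ`. -/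
def HasValidBits {σ : Type*} (μ ν : σ → ℝ) (i : ℕ) : Prop :=
  ∀ j : σ, |μ j - ν j| / |μ j| ≤ (1 / 2 : ℝ) ^ i

/-! ### Probabilistic pushdown automata -/

/-- A probabilistic pushdown automaton with finite sets `Q` of control states and `Γ` of stack
letters. `(q, α) ∈ rules p X` means that `pX → qα` is a transition, and `prob p X (q, α)` is then
its probability (values of `prob` outside the transition relation play no role). As usual, the
words `α` have length at most two. -/
structure PPDA (Q Γ : Type*) where
  rules : Q → Γ → Finset (Q × List Γ)
  prob : Q → Γ → Q × List Γ → ℝ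
  prob_pos : ∀ p X, ∀ r ∈ rules p X, 0 < prob p X r
  prob_le_one : ∀ p X, ∀ r ∈ rules p X, prob p X r ≤ 1
  sum_prob : ∀ p X, ∑ r ∈ rules p X, prob p X r = 1
  length_le : ∀ p X, ∀ r ∈ rules p X, r.2.length ≤ 2

namespace PPDA

variable {Q Γ : Type*}

/-- A pPDA is strict if it has a pop-rule `pX → qε` for all `p`, `X`, `q`. -/
def Strict (P : PPDA Q Γ) : Prop :=
  ∀ (p : Q) (X : Γ) (q : Q), (q, []) ∈ P.rules p X

/-- What a transition with target control state `r` and pushed word `α` contributes to the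
equation of a variable `[pXq]`, up to its probability: `1` (if `r = q`) or `0` for `α = ε`,
the variable `[rYq]` for `α = Y`, and `∑ t, [rYt] · [tZq]` for `α = YZ`. -/
noncomputable def termMonomials [Fintype Q] [DecidableEq Q] (q r : Q) :
    List Γ → MvPolynomial (Q × Γ × Q) ℝ
  | [] => if r = q then 1 else 0
  | [Y] => MvPolynomial.X (r, Y, q)
  | [Y, Z] => ∑ t : Q, MvPolynomial.X (r, Y, t) * MvPolynomial.X (t, Z, q)
  | _ => 0

/-- The termination system of a pPDA: its variables are the triples `[pXq]`, and it contains one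
equation for each of them. -/
noncomputable def terminationSystem [Fintype Q] [DecidableEq Q] (P : PPDA Q Γ) :
    PolySystem (Q × Γ × Q) :=
  fun v => ∑ r ∈ P.rules v.1 v.2.1,
    MvPolynomial.C (P.prob v.1 v.2.1 r) * termMonomials v.2.2 r.1 r.2

end PPDA

open Filter Topology Matrix

/-! The termination system is a quadratic map `f` with non-negative coefficients. Strictness makes
its constant terms positive, and its Kleene iterates remain sub-probabilities, so they converge to
the least fixed point `μ ≤ 1`. Since `f` is quadratic, its second-order Taylor expansion is exact,
and error estimates become linear inequalities for the Jacobian.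

Two facts carry the convergence proof. At each Newton iterate `x` the matrix `1 - f'(x)` reflects
non-negativity, hence is invertible with a monotone inverse (`Below.reflects`). And there is a
non-negative `d ≠ 0` with `f'(μ) d ≤ d`, obtained by compactness from normalised Kleene errors
(`exists_nonneg_jac_mulVec_le`); strong connectedness makes it positive. If the error `e = μ - x`
satisfies `e ≤ r d`, then `(1 - f'(x)) d ≥ 2 B(d, e)`, while the next error `e'` satisfies `(1 -
f'(x)) e' = B(e, e) ≤ r B(d, e)`. Hence `e' ≤ (r/2) d`: each step gains one bit (`Below.step_le`).

The initial cost is governed by `d_min / d_max ≥ γ^n` with `γ = c_min · min {μ_min, 1}`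
(`pow_mul_le_of_dep`), so `log₂ (μ_max / (μ_min γ^n)) ≤ k_f` steps suffice before the valid bits
start. The bound `3nm` follows from `μ_max ≤ 1` and `μ_min ≥ c_min ≥ 2^(-m)`. -/

/-- A quadratic map `x ↦ c + L x + B(x, x)` with non-negative coefficients and symmetric `B`. -/
structure QuadSystem (σ : Type*) where
  const : σ → ℝ
  lin : Matrix σ σ ℝ
  quad : σ → Matrix σ σ ℝ
  const_nonneg : ∀ i, 0 ≤ const i
  lin_nonneg : ∀ i j, 0 ≤ lin i j
  quad_nonneg : ∀ i j k, 0 ≤ quad i j k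
  quad_symm : ∀ i j k, quad i j k = quad i k j

/-! ### Non-negative matrices `A` and monotonicity of `(1 - A)⁻¹`. -/

theorem Matrix.mulVec_nonneg_of_nonneg {σ : Type*} [Fintype σ] {A : Matrix σ σ ℝ}
    (hA : ∀ i j, 0 ≤ A i j) {x : σ → ℝ} (hx : 0 ≤ x) : 0 ≤ A *ᵥ x := fun i =>
  Finset.sum_nonneg fun j _ => mul_nonneg (hA i j) (hx j)

/-- If a non-negative matrix `A` has a positive vector `v` with `A v ≤ v`, strictly somewhere on
each non-empty set of indices that is closed under the edges of `A`, then `1 - A` reflects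
non-negativity. -/
theorem Matrix.nonneg_of_mulVec_le {σ : Type*} [Fintype σ] {A : Matrix σ σ ℝ}
    (hA : ∀ i j, 0 ≤ A i j) {v : σ → ℝ} (hv : ∀ i, 0 < v i) (hAv : A *ᵥ v ≤ v)
    (hS : ∀ S : Set σ, S.Nonempty → (∀ i ∈ S, ∀ j, 0 < A i j → j ∈ S) →
      ∃ j ∈ S, (A *ᵥ v) j < v j)
    {x : σ → ℝ} (hx : A *ᵥ x ≤ x) : 0 ≤ x := by
  by_contra hneg
  have : ∃ i, x i < 0 := by
    by_contra! h
    exact hneg h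
  obtain ⟨i₀, hi₀⟩ := this
  -- Subtract the multiple of `v` that makes `x - t • v` non-negative and zero at `a`. As `t < 0`,
  -- the zero set of this vector is closed under the edges of `A`, and `A v = v` would have to hold
  -- on it.
  obtain ⟨a, -, ha⟩ := Finset.exists_min_image Finset.univ (fun i => x i / v i) ⟨i₀, by simp⟩
  set t := x a / v a with ht
  have ht0 : t < 0 := (ha i₀ (by simp)).trans_lt (div_neg_of_neg_of_pos hi₀ (hv i₀))
  have hy : 0 ≤ x - t • v := fun i => by
    have := (le_div_iff₀ (hv i)).1 (ha i (by simp))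
    simpa using this
  have hAy : A *ᵥ (x - t • v) = A *ᵥ x - t • A *ᵥ v := by
    rw [mulVec_sub, mulVec_smul]
  have hAy0 := mulVec_nonneg_of_nonneg hA hy
  have hle : ∀ i, (A *ᵥ (x - t • v)) i ≤ (x - t • v) i - (-t) * (v i - (A *ᵥ v) i) := fun i => by
    have := hx i
    simp only [hAy, Pi.sub_apply, Pi.smul_apply, smul_eq_mul]
    linarith
  obtain ⟨j, hj, hlt⟩ := hS {i | (x - t • v) i = 0}
    ⟨a, by simp [ht, div_mul_cancel₀ _ (hv a).ne']⟩ (by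
      intro i hi j hij
      have h1 := hle i
      have h2 := mul_nonneg (neg_nonneg.2 ht0.le) (sub_nonneg.2 (hAv i))
      have h3 : A i j * (x - t • v) j ≤ (A *ᵥ (x - t • v)) i :=
        Finset.single_le_sum (f := fun j => A i j * (x - t • v) j)
          (fun k _ => mul_nonneg (hA i k) (hy k)) (Finset.mem_univ j)
      have hi' : (x - t • v) i = 0 := hi
      have h4 : (x - t • v) j ≤ 0 := by
        by_contra! h
        have := mul_pos hij h
        linarith
      exact le_antisymm h4 (hy j))
  have h1 := hle j
  have h2 : 0 < -t * (v j - (A *ᵥ v) j) := mul_pos (neg_pos.2 ht0) (sub_pos.2 hlt)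
  have h3 := hAy0 j
  have hj' : (x - t • v) j = 0 := hj
  simp only [Pi.zero_apply] at h3
  linarith

/-- A matrix `1 - A` that reflects non-negativity is invertible. -/
theorem Matrix.isUnit_one_sub_of_reflects {σ : Type*} [Fintype σ] [DecidableEq σ]
    {A : Matrix σ σ ℝ} (h : ∀ x, A *ᵥ x ≤ x → 0 ≤ x) : IsUnit (1 - A) := by
  rw [← mulVec_injective_iff_isUnit]
  intro x y hxy
  have hxy' : (1 - A) *ᵥ x = (1 - A) *ᵥ y := hxy
  simp only [sub_mulVec, one_mulVec] at hxy'
  have key : A *ᵥ (x - y) = x - y := by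
    rw [mulVec_sub]
    linear_combination (exp := 1) -hxy'
  have h1 := h (x - y) key.le
  have h2 := h (y - x) (by
    rw [← neg_sub x y, mulVec_neg, key])
  exact le_antisymm (sub_nonneg.1 h2) (sub_nonneg.1 h1)

/-! ### Quadratic maps: exact Taylor expansion and monotonicity. -/

namespace QuadSystem

variable {σ : Type*} [Fintype σ] (q : QuadSystem σ)

def bil (x y : σ → ℝ) : σ → ℝ := fun i => x ⬝ᵥ q.quad i *ᵥ y

def value (x : σ → ℝ) : σ → ℝ := q.const + q.lin *ᵥ x + q.bil x x

def jac (x : σ → ℝ) : Matrix σ σ ℝ := of fun i j => q.lin i j + 2 * (q.quad i *ᵥ x) j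

def Dep (i j : σ) : Prop := 0 < q.lin i j ∨ ∃ k, 0 < q.quad i j k

theorem bil_comm (x y : σ → ℝ) : q.bil x y = q.bil y x := by
  funext i
  have : (q.quad i)ᵀ = q.quad i := by
    ext j k
    exact q.quad_symm i k j
  rw [bil, bil, dotProduct_mulVec, ← mulVec_transpose, this, dotProduct_comm]

theorem bil_nonneg {x y : σ → ℝ} (hx : 0 ≤ x) (hy : 0 ≤ y) : 0 ≤ q.bil x y := fun i =>
  Finset.sum_nonneg fun j _ => mul_nonneg (hx j) (mulVec_nonneg_of_nonneg (q.quad_nonneg i) hy j)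

theorem bil_add_right (x y z : σ → ℝ) : q.bil x (y + z) = q.bil x y + q.bil x z := by
  funext i
  simp [bil, mulVec_add, dotProduct_add]

theorem bil_smul_right (t : ℝ) (x y : σ → ℝ) : q.bil x (t • y) = t • q.bil x y := by
  funext i
  simp [bil, mulVec_smul, dotProduct_smul]

theorem bil_add_left (x y z : σ → ℝ) : q.bil (x + y) z = q.bil x z + q.bil y z := by
  rw [bil_comm, bil_add_right, bil_comm, q.bil_comm z]

theorem bil_sub_right (x y z : σ → ℝ) : q.bil x (y - z) = q.bil x y - q.bil x z := by
  funext i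
  simp [bil, mulVec_sub, dotProduct_sub]

theorem bil_pos {x y : σ → ℝ} (hx : ∀ i, 0 < x i) (hy : ∀ i, 0 < y i) {i : σ}
    (hi : q.quad i ≠ 0) : 0 < q.bil x y i := by
  obtain ⟨j, k, hjk⟩ : ∃ j k, q.quad i j k ≠ 0 := by
    by_contra! h
    exact hi (by ext j k; exact h j k)
  have hpos := lt_of_le_of_ne (q.quad_nonneg i j k) hjk.symm
  have h0 := mulVec_nonneg_of_nonneg (q.quad_nonneg i) (fun i => (hy i).le)
  refine Finset.sum_pos' (fun j _ => mul_nonneg (hx j).le (h0 j))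
    ⟨j, Finset.mem_univ j, mul_pos (hx j) ?_⟩
  exact Finset.sum_pos' (fun l _ => mul_nonneg (q.quad_nonneg i j l) (hy l).le)
    ⟨k, Finset.mem_univ k, mul_pos hpos (hy k)⟩

theorem bil_eq_zero (h : q.quad = 0) (x y : σ → ℝ) : q.bil x y = 0 := by
  funext i
  simp [bil, h]

theorem jac_mulVec (x y : σ → ℝ) : q.jac x *ᵥ y = q.lin *ᵥ y + (2 : ℝ) • q.bil y x := by
  funext i
  simp [jac, bil, mulVec, dotProduct, Finset.mul_sum, ← Finset.sum_add_distrib, add_mul]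
  refine Finset.sum_congr rfl fun j _ => ?_
  rw [Finset.sum_mul]
  congr 1
  refine Finset.sum_congr rfl fun k _ => ?_
  ring

theorem jac_add_mulVec (x h y : σ → ℝ) :
    q.jac (x + h) *ᵥ y = q.jac x *ᵥ y + (2 : ℝ) • q.bil y h := by
  rw [jac_mulVec, jac_mulVec, bil_add_right, smul_add, add_assoc]

theorem value_add (x h : σ → ℝ) :
    q.value (x + h) = q.value x + q.jac x *ᵥ h + q.bil h h := by
  rw [value, value, jac_mulVec, bil_add_left, bil_add_right, bil_add_right, q.bil_comm x h,
    mulVec_add, two_smul]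
  abel

theorem value_zero : q.value 0 = q.const := by
  funext i
  simp [value, bil]

theorem jac_nonneg {x : σ → ℝ} (hx : 0 ≤ x) (i j : σ) : 0 ≤ q.jac x i j :=
  add_nonneg (q.lin_nonneg i j)
    (mul_nonneg zero_le_two (mulVec_nonneg_of_nonneg (q.quad_nonneg i) hx j))

theorem jac_pos_of_lin_pos {x : σ → ℝ} (hx : 0 ≤ x) {i j : σ} (h : 0 < q.lin i j) :
    0 < q.jac x i j :=
  add_pos_of_pos_of_nonneg h
    (mul_nonneg zero_le_two (mulVec_nonneg_of_nonneg (q.quad_nonneg i) hx j))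

theorem value_mono {x y : σ → ℝ} (hx : 0 ≤ x) (hxy : x ≤ y) : q.value x ≤ q.value y := by
  have h0 : 0 ≤ y - x := sub_nonneg.2 hxy
  have := q.value_add x (y - x)
  rw [add_sub_cancel] at this
  rw [this, add_assoc]
  exact le_add_of_nonneg_right
    (add_nonneg (mulVec_nonneg_of_nonneg (q.jac_nonneg hx) h0) (q.bil_nonneg h0 h0))

theorem value_nonneg {x : σ → ℝ} (hx : 0 ≤ x) : 0 ≤ q.value x :=
  (show (0 : σ → ℝ) ≤ q.const from q.const_nonneg).trans
    (q.value_zero ▸ q.value_mono le_rfl hx)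

theorem continuous_bil_right (x : σ → ℝ) : Continuous (q.bil x) :=
  continuous_pi fun _ => continuous_const.dotProduct (continuous_const.matrix_mulVec continuous_id)

theorem continuous_value : Continuous q.value := by
  refine (continuous_const.add (continuous_const.matrix_mulVec continuous_id)).add ?_
  exact continuous_pi fun _ =>
    continuous_id.dotProduct (continuous_const.matrix_mulVec continuous_id)

/-! #### The Kleene iteration -/

def kleene (k : ℕ) : σ → ℝ := q.value^[k] 0

theorem kleene_succ (k : ℕ) : q.kleene (k + 1) = q.value (q.kleene k) :=
  Function.iterate_succ_apply' _ _ _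

theorem kleene_nonneg (k : ℕ) : 0 ≤ q.kleene k := by
  induction k with
  | zero => exact le_rfl
  | succ k ih => exact q.kleene_succ k ▸ q.value_nonneg ih

theorem kleene_le_succ (k : ℕ) : q.kleene k ≤ q.kleene (k + 1) := by
  induction k with
  | zero => exact q.kleene_nonneg 1
  | succ k ih =>
    rw [kleene_succ, q.kleene_succ (k + 1)]
    exact q.value_mono (q.kleene_nonneg k) ih

theorem kleene_le {x : σ → ℝ} (hx : 0 ≤ x) (hfx : q.value x ≤ x) (k : ℕ) : q.kleene k ≤ x := by
  induction k with
  | zero => exact hx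
  | succ k ih =>
    rw [kleene_succ]
    exact (q.value_mono (q.kleene_nonneg k) ih).trans hfx

theorem exists_tendsto_kleene {b : σ → ℝ} (hb : ∀ k, q.kleene k ≤ b) :
    ∃ μ : σ → ℝ, Tendsto q.kleene atTop (𝓝 μ) ∧ 0 ≤ μ ∧ μ ≤ b ∧ q.value μ = μ ∧
      ∀ x, 0 ≤ x → q.value x = x → μ ≤ x := by
  have hmono : Monotone q.kleene := monotone_nat_of_le_succ q.kleene_le_succ
  have hlim : Tendsto q.kleene atTop (𝓝 fun i => ⨆ k, q.kleene k i) :=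
    tendsto_pi_nhds.2 fun i => tendsto_atTop_ciSup (fun _ _ h => hmono h i)
      ⟨b i, by rintro _ ⟨k, rfl⟩; exact hb k i⟩
  refine ⟨_, hlim, ge_of_tendsto' hlim q.kleene_nonneg, le_of_tendsto' hlim hb, ?_,
    fun x hx hfx => le_of_tendsto' hlim (q.kleene_le hx hfx.le)⟩
  have h1 := (q.continuous_value.tendsto _).comp hlim
  have h2 := hlim.comp (tendsto_add_atTop_nat 1)
  refine tendsto_nhds_unique h1 (h2.congr fun k => ?_)
  exact q.kleene_succ k

/-! #### A positive vector that the Jacobian at the fixed point does not increase -/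

/-- The exact expansion at `x` reads `μ = f(x) + f'(x)(μ - x) + B(μ - x, μ - x)`; drop the last term
and use `x ≤ f(x)`. -/
theorem sub_ge_jac_mulVec {x μ : σ → ℝ} (hxμ : x ≤ μ) (hx : x ≤ q.value x)
    (hμ : q.value μ = μ) : q.jac x *ᵥ (μ - x) ≤ μ - x := by
  have h0 : 0 ≤ μ - x := sub_nonneg.2 hxμ
  have h := q.value_add x (μ - x)
  rw [add_sub_cancel, hμ] at h
  intro i
  have h1 := congrFun h i
  have h2 := hx i
  have h3 := q.bil_nonneg h0 h0 i
  simp only [Pi.add_apply, Pi.sub_apply, Pi.zero_apply] at *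
  linarith

theorem exists_nonneg_jac_mulVec_le {μ : σ → ℝ} (hlim : Tendsto q.kleene atTop (𝓝 μ))
    (hle : ∀ k, q.kleene k ≤ μ) (hμ0 : μ ≠ 0) (hμ : q.value μ = μ) :
    ∃ d : σ → ℝ, 0 ≤ d ∧ d ≠ 0 ∧ q.jac μ *ᵥ d ≤ d := by
  by_cases hne : ∀ k, q.kleene k ≠ μ
  -- The sets `D k` are compact, and they decrease because the Jacobian grows along the Kleene
  -- sequence. Each contains the normalised error `μ - κ⁽ᵏ⁾`, so they have a common point, and
  -- `f'(κ⁽ᵏ⁾) d ≤ d` passes to the limit.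
  · let D : ℕ → Set (σ → ℝ) := fun k => {d | d ∈ stdSimplex ℝ σ ∧ q.jac (q.kleene k) *ᵥ d ≤ d}
    have hcl : ∀ k, IsClosed {d : σ → ℝ | q.jac (q.kleene k) *ᵥ d ≤ d} := fun k =>
      isClosed_le (continuous_const.matrix_mulVec continuous_id) continuous_id
    have hcomp : ∀ k, IsCompact (D k) := fun k =>
      (isCompact_stdSimplex ℝ σ).inter_right (hcl k)
    obtain ⟨d, hd⟩ := IsCompact.nonempty_iInter_of_sequence_nonempty_isCompact_isClosed D
      (by
        rintro k d ⟨hd, hd'⟩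
        refine ⟨hd, le_trans ?_ hd'⟩
        have h0 := sub_nonneg.2 (q.kleene_le_succ k)
        have := q.jac_add_mulVec (q.kleene k) (q.kleene (k + 1) - q.kleene k) d
        rw [add_sub_cancel] at this
        rw [this]
        exact le_add_of_nonneg_right (smul_nonneg zero_le_two (q.bil_nonneg hd.1 h0)))
      (by
        intro k
        set e := μ - q.kleene k with he
        have he0 : 0 ≤ e := sub_nonneg.2 (hle k)
        have hs : 0 < ∑ i, e i := by
          refine lt_of_le_of_ne (Finset.sum_nonneg fun i _ => he0 i) fun h => hne k ?_
          have := (Finset.sum_eq_zero_iff_of_nonneg fun i _ => he0 i).1 h.symm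
          refine (sub_eq_zero.1 ?_).symm
          funext i
          exact this i (Finset.mem_univ i)
        have hse : q.jac (q.kleene k) *ᵥ e ≤ e :=
          q.sub_ge_jac_mulVec (hle k) (q.kleene_succ k ▸ q.kleene_le_succ k) hμ
        refine ⟨(∑ i, e i)⁻¹ • e, ⟨fun i => mul_nonneg (inv_nonneg.2 hs.le) (he0 i), ?_⟩, ?_⟩
        · simp only [Pi.smul_apply, smul_eq_mul, ← Finset.mul_sum]
          exact inv_mul_cancel₀ hs.ne'
        · rw [mulVec_smul]
          exact smul_le_smul_of_nonneg_left hse (inv_nonneg.2 hs.le))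
      (hcomp 0) (fun k => (hcomp k).isClosed)
    rw [Set.mem_iInter] at hd
    refine ⟨d, (hd 0).1.1, ?_, ?_⟩
    · rintro rfl
      simpa using (hd 0).1.2
    · have hc : Continuous fun x => q.jac x *ᵥ d := by
        simp only [jac_mulVec]
        exact continuous_const.add (Continuous.fun_const_smul (q.continuous_bil_right d) 2)
      exact le_of_tendsto' ((hc.tendsto μ).comp hlim) fun k => (hd k).2
  · have hex : ∃ k, q.kleene k = μ := by
      by_contra! h
      exact hne h
    classical
    -- If the iteration reaches `μ`, take the last non-zero error `e`. From `f(κ⁽ᵏ⁾) = μ = f(μ)` the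
    -- expansion leaves `f'(κ⁽ᵏ⁾) e + B(e, e) = 0`; both terms are non-negative, so both vanish and
    -- `f'(μ) e = 0`.
    obtain ⟨k, hk⟩ : ∃ k, Nat.find hex = k + 1 := by
      refine Nat.exists_eq_succ_of_ne_zero fun h => hμ0 ?_
      rw [← Nat.find_spec hex, h]
      rfl
    have hk1 : q.kleene (k + 1) = μ := hk ▸ Nat.find_spec hex
    have hk0 : q.kleene k ≠ μ := Nat.find_min hex (by omega)
    have he0 : 0 ≤ μ - q.kleene k := sub_nonneg.2 (hle k)
    refine ⟨μ - q.kleene k, he0, fun h => hk0 (sub_eq_zero.1 h).symm, ?_⟩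
    have h := q.value_add (q.kleene k) (μ - q.kleene k)
    have h' := q.jac_add_mulVec (q.kleene k) (μ - q.kleene k) (μ - q.kleene k)
    rw [add_sub_cancel, hμ, ← kleene_succ, hk1] at h
    rw [add_sub_cancel] at h'
    rw [h']
    intro i
    have h1 := congrFun h i
    have h2 := he0 i
    have h3 := mulVec_nonneg_of_nonneg (q.jac_nonneg (q.kleene_nonneg k)) he0 i
    have h4 := q.bil_nonneg he0 he0 i
    simp only [Pi.add_apply, Pi.smul_apply, smul_eq_mul, Pi.zero_apply] at *
    linarith

variable {q}

/-- Since `μ` is positive, every dependence is a positive entry of `f'(μ)`. A zero of `d` therefore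
spreads along dependences, and would make `d` vanish everywhere. -/
theorem pos_of_jac_mulVec_le
    (hconn : ∀ S : Set σ, S.Nonempty → (∀ i ∈ S, ∀ j, q.Dep i j → j ∈ S) → S = Set.univ)
    {μ d : σ → ℝ} (hμ : ∀ i, 0 < μ i) (hd : 0 ≤ d) (hd0 : d ≠ 0) (hjd : q.jac μ *ᵥ d ≤ d)
    (i : σ) : 0 < d i := by
  refine lt_of_le_of_ne (hd i) fun hi => hd0 ?_
  have huniv := hconn {i | d i = 0} ⟨i, hi.symm⟩ (by
    intro i hi j hij
    have hpos : 0 < q.jac μ i j := by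
      rcases hij with h | ⟨k, hk⟩
      · exact q.jac_pos_of_lin_pos (fun i => (hμ i).le) h
      · refine add_pos_of_nonneg_of_pos (q.lin_nonneg i j) (mul_pos two_pos ?_)
        exact Finset.sum_pos' (fun l _ => mul_nonneg (q.quad_nonneg i j l) (hμ l).le)
          ⟨k, Finset.mem_univ k, mul_pos hk (hμ k)⟩
    have h1 : q.jac μ i j * d j ≤ (q.jac μ *ᵥ d) i :=
      Finset.single_le_sum (f := fun j => q.jac μ i j * d j)
        (fun k _ => mul_nonneg (q.jac_nonneg (fun i => (hμ i).le) i k) (hd k)) (Finset.mem_univ j)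
    have h2 := hjd i
    have hi' : d i = 0 := hi
    refine le_antisymm ?_ (hd j)
    by_contra! h
    have := mul_pos hpos h
    linarith)
  funext j
  exact (huniv ▸ Set.mem_univ j : j ∈ {i | d i = 0})

/-- The components of `d` differ at most by a factor `γ ^ n`, if they decrease at most by a factor
`γ` along each dependence. -/
theorem pow_mul_le_of_dep
    (hconn : ∀ S : Set σ, S.Nonempty → (∀ i ∈ S, ∀ j, q.Dep i j → j ∈ S) → S = Set.univ)
    {d : σ → ℝ} {γ : ℝ} (hγ0 : 0 ≤ γ) (hγ1 : γ ≤ 1) (hd : 0 ≤ d)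
    (hdep : ∀ i j, q.Dep i j → γ * d j ≤ d i) (i j : σ) :
    γ ^ Fintype.card σ * d j ≤ d i := by
  classical
  let T : ℕ → Finset σ := fun t => Finset.univ.filter fun i => γ ^ t * d j ≤ d i
  have hT : ∀ t, T t ⊆ T (t + 1) := fun t i hi => by
    simp only [T, Finset.mem_filter, Finset.mem_univ, true_and] at hi ⊢
    refine le_trans (mul_le_mul_of_nonneg_right ?_ (hd j)) hi
    exact pow_le_pow_of_le_one hγ0 hγ1 (Nat.le_succ t)
  have hjT : ∀ t, j ∈ T t := fun t => by
    simp only [T, Finset.mem_filter, Finset.mem_univ, true_and]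
    exact mul_le_of_le_one_left (hd j) (pow_le_one₀ hγ0 hγ1)
  -- `T t` gains an index at every step until it is everything: otherwise its complement would be
  -- closed under dependence.
  have key : ∀ t, T t = Finset.univ ∨ t + 1 ≤ (T t).card := by
    intro t
    induction t with
    | zero => exact Or.inr (Finset.card_pos.2 ⟨j, hjT 0⟩)
    | succ t ih =>
      by_cases hu : T t = Finset.univ
      · exact Or.inl (Finset.univ_subset_iff.1 (hu ▸ hT t))
      · refine Or.inr ?_
        have ih := ih.resolve_left hu
        obtain ⟨a, ha, b, hab, hb⟩ : ∃ a, a ∉ T t ∧ ∃ b, q.Dep a b ∧ b ∈ T t := by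
          by_contra! h
          obtain ⟨a, ha⟩ : ∃ a, a ∉ T t := by
            by_contra! h'
            exact hu (Finset.eq_univ_iff_forall.2 h')
          have := hconn {a | a ∉ T t} ⟨a, ha⟩ (fun a ha b hab => h a ha b hab)
          exact (this ▸ Set.mem_univ j : j ∈ {a | a ∉ T t}) (hjT t)
        have ha' : a ∈ T (t + 1) := by
          simp only [T, Finset.mem_filter, Finset.mem_univ, true_and] at hb ⊢
          refine le_trans ?_ (hdep a b hab)
          rw [pow_succ', mul_assoc]
          exact mul_le_mul_of_nonneg_left hb hγ0
        have := Finset.card_lt_card (Finset.ssubset_iff_of_subset (hT t) |>.2 ⟨a, ha', ha⟩)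
        omega
  have hfin : i ∈ T (Fintype.card σ) := by
    rcases key (Fintype.card σ) with h | h
    · simp [h]
    · have := Finset.card_le_univ (T (Fintype.card σ))
      omega
  simpa [T] using hfin

/-! #### Newton's method -/

/-- What holds of all Newton iterates. -/
structure Below (q : QuadSystem σ) (μ x : σ → ℝ) : Prop where
  nonneg : 0 ≤ x
  le : x ≤ μ
  le_value : x ≤ q.value x
  -- In the linear case the first Newton step already reaches `μ`, so strictness is only kept when
  -- some quadratic coefficient is non-zero.
  lt : q.quad ≠ 0 → ∀ i, x i < μ i

/-- The test vector for `nonneg_of_mulVec_le` is `μ` in the linear case, where `f'(x) μ = μ - c <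
μ`, and `μ - x` otherwise. In the latter case `B(μ - x, μ - x)` gives strictness in every row with a
quadratic coefficient. A closed set without such rows has only linear dependences, so it would be
everything and `f` would be linear. -/
theorem Below.reflects
    (hconn : ∀ S : Set σ, S.Nonempty → (∀ i ∈ S, ∀ j, q.Dep i j → j ∈ S) → S = Set.univ)
    {μ x : σ → ℝ} (hpos : ∀ i, 0 < μ i) (hconst : ∀ i, 0 < q.const i) (hμ : q.value μ = μ)
    (h : q.Below μ x) {y : σ → ℝ} (hy : q.jac x *ᵥ y ≤ y) : 0 ≤ y := by
  by_cases hq : q.quad = 0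
  · have hlt : ∀ i, (q.jac x *ᵥ μ) i < μ i := fun i => by
      have h1 := congrFun hμ i
      rw [jac_mulVec, q.bil_eq_zero hq]
      rw [value, q.bil_eq_zero hq] at h1
      have := hconst i
      simp only [smul_zero, Pi.add_apply] at *
      linarith
    exact nonneg_of_mulVec_le (q.jac_nonneg h.nonneg) hpos (fun i => (hlt i).le)
      (fun S ⟨i, hi⟩ _ => ⟨i, hi, hlt i⟩) hy
  · have hlt := h.lt hq
    have he : ∀ i, 0 < (μ - x) i := fun i => sub_pos.2 (hlt i)
    refine nonneg_of_mulVec_le (q.jac_nonneg h.nonneg) he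
      (q.sub_ge_jac_mulVec h.le h.le_value hμ) (fun S hS hcl => ?_) hy
    by_contra! hno
    have hzero : ∀ i ∈ S, q.quad i = 0 := fun i hi => by
      by_contra hqi
      have h1 := q.bil_pos he he hqi
      have h2 := hno i hi
      have h3 := congrFun (q.value_add x (μ - x)) i
      have h4 := h.le_value i
      rw [add_sub_cancel, hμ] at h3
      simp only [Pi.add_apply, Pi.sub_apply] at *
      linarith
    have huniv := hconn S hS fun i hi j hij => hcl i hi j (by
      rcases hij with h1 | ⟨k, hk⟩
      · exact q.jac_pos_of_lin_pos h.nonneg h1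
      · simp [hzero i hi] at hk)
    exact hq (funext fun i => hzero i (huniv ▸ Set.mem_univ i))

section Step

variable {μ x δ : σ → ℝ}

theorem sub_newton_step (hμ : q.value μ = μ) (hδ : δ - q.jac x *ᵥ δ = q.value x - x) :
    (μ - (x + δ)) - q.jac x *ᵥ (μ - (x + δ)) = q.bil (μ - x) (μ - x) := by
  have h := q.value_add x (μ - x)
  rw [add_sub_cancel, hμ] at h
  have h1 : q.jac x *ᵥ (μ - (x + δ)) = q.jac x *ᵥ (μ - x) - q.jac x *ᵥ δ := by
    rw [← mulVec_sub]
    congr 1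
    abel
  rw [h1]
  linear_combination (exp := 1) h - hδ

/-- The step `δ` and the new error are non-negative because `1 - f'(x)` maps them to `f(x) - x` and
`B(μ - x, μ - x)`. Moreover `f(x + δ) - (x + δ) = B(δ, δ)`. A zero of the new error forces its row
to have no quadratic coefficient and spreads along the linear ones, so it would make `f` linear. -/
theorem Below.step
    (hconn : ∀ S : Set σ, S.Nonempty → (∀ i ∈ S, ∀ j, q.Dep i j → j ∈ S) → S = Set.univ)
    (hpos : ∀ i, 0 < μ i) (hconst : ∀ i, 0 < q.const i) (hμ : q.value μ = μ)
    (h : q.Below μ x) (hδ : δ - q.jac x *ᵥ δ = q.value x - x) : q.Below μ (x + δ) := by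
  have hδ0 : 0 ≤ δ := h.reflects hconn hpos hconst hμ
    (sub_nonneg.1 (hδ ▸ sub_nonneg.2 h.le_value))
  have he0 : 0 ≤ μ - x := sub_nonneg.2 h.le
  have hstep := sub_newton_step hμ hδ
  have he'0 : 0 ≤ μ - (x + δ) := h.reflects hconn hpos hconst hμ
    (sub_nonneg.1 (hstep ▸ q.bil_nonneg he0 he0))
  refine ⟨add_nonneg h.nonneg hδ0, sub_nonneg.1 he'0, ?_, fun hq i => ?_⟩
  · rw [value_add]
    refine le_trans (le_of_eq ?_) (le_add_of_nonneg_right (q.bil_nonneg hδ0 hδ0))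
    linear_combination (exp := 1) hδ
  · refine sub_pos.1 (lt_of_le_of_ne (he'0 i) fun hi => hq ?_)
    have he : ∀ i, 0 < (μ - x) i := fun i => sub_pos.2 (h.lt hq i)
    have hrow : ∀ i, (μ - (x + δ)) i = 0 →
        (q.jac x *ᵥ (μ - (x + δ))) i = 0 ∧ q.quad i = 0 := fun i hi => by
      have h1 := congrFun hstep i
      have h2 := mulVec_nonneg_of_nonneg (q.jac_nonneg h.nonneg) he'0 i
      have h3 := q.bil_nonneg he0 he0 i
      rw [Pi.sub_apply, hi] at h1
      simp only [Pi.zero_apply] at h2 h3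
      refine ⟨by linarith, ?_⟩
      by_contra hqi
      have := q.bil_pos he he hqi
      linarith
    have huniv := hconn {i | (μ - (x + δ)) i = 0} ⟨i, hi.symm⟩ (by
      intro i hi j hij
      obtain ⟨h1, h2⟩ := hrow i hi
      have hij' : 0 < q.jac x i j := by
        rcases hij with h3 | ⟨k, hk⟩
        · exact q.jac_pos_of_lin_pos h.nonneg h3
        · simp [h2] at hk
      have h3 := (Finset.sum_eq_zero_iff_of_nonneg
        (fun k _ => mul_nonneg (q.jac_nonneg h.nonneg i k) (he'0 k))).1 h1 j (Finset.mem_univ j)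
      exact (mul_eq_zero.1 h3).resolve_left hij'.ne')
    exact funext fun i => (hrow i (huniv ▸ Set.mem_univ i : i ∈ {i | (μ - (x + δ)) i = 0})).2

/-- A Newton step halves the distance to the fixed point, measured along `d`. -/
theorem Below.step_le
    (hconn : ∀ S : Set σ, S.Nonempty → (∀ i ∈ S, ∀ j, q.Dep i j → j ∈ S) → S = Set.univ)
    (hpos : ∀ i, 0 < μ i) (hconst : ∀ i, 0 < q.const i) (hμ : q.value μ = μ)
    (h : q.Below μ x) (hδ : δ - q.jac x *ᵥ δ = q.value x - x)
    {d : σ → ℝ} (hd : q.jac μ *ᵥ d ≤ d) {r : ℝ} (hr : 0 ≤ r) (hx : μ - x ≤ r • d) :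
    μ - (x + δ) ≤ (r / 2) • d := by
  have he0 : 0 ≤ μ - x := sub_nonneg.2 h.le
  rw [← sub_nonneg]
  refine h.reflects hconn hpos hconst hμ fun i => ?_
  have h1 := congrFun (sub_newton_step hμ hδ) i
  have h2 := congrFun (q.jac_add_mulVec x (μ - x) d) i
  have h3 := q.bil_nonneg he0 (sub_nonneg.2 hx) i
  rw [bil_sub_right, bil_smul_right, bil_comm] at h3
  rw [add_sub_cancel] at h2
  have h4 := mul_le_mul_of_nonneg_left (hd i) hr
  rw [mulVec_sub, mulVec_smul]
  simp only [Pi.sub_apply, Pi.add_apply, Pi.smul_apply, smul_eq_mul, Pi.zero_apply] at *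
  rw [h2] at h4
  linarith

end Step

end QuadSystem

/-! ### Newton iterates of a polynomial system. -/

namespace PolySystem

variable {σ : Type*} [Fintype σ] [DecidableEq σ] {f : PolySystem σ} {q : QuadSystem σ}

theorem newton_below (hval : f.value = q.value) (hjac : f.jacobian = q.jac)
    (hconn : ∀ S : Set σ, S.Nonempty → (∀ i ∈ S, ∀ j, q.Dep i j → j ∈ S) → S = Set.univ)
    {μ : σ → ℝ} (hpos : ∀ i, 0 < μ i) (hconst : ∀ i, 0 < q.const i) (hμ : q.value μ = μ)
    {d : σ → ℝ} (hd : q.jac μ *ᵥ d ≤ d) {r : ℝ} (hr : 0 ≤ r) (hrd : μ ≤ r • d) (k : ℕ) :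
    IsUnit (1 - f.jacobian (f.newton k)) ∧ q.Below μ (f.newton k) ∧
      μ - f.newton k ≤ (r / 2 ^ k) • d := by
  have hunit : ∀ k, q.Below μ (f.newton k) → IsUnit (1 - f.jacobian (f.newton k)) :=
    fun k h => hjac ▸ isUnit_one_sub_of_reflects fun _ => h.reflects hconn hpos hconst hμ
  suffices q.Below μ (f.newton k) ∧ μ - f.newton k ≤ (r / 2 ^ k) • d from ⟨hunit k this.1, this⟩
  induction k with
  | zero =>
    refine ⟨⟨le_rfl, fun i => (hpos i).le, q.value_nonneg le_rfl, fun _ => hpos⟩, ?_⟩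
    simpa [newton] using hrd
  | succ k ih =>
    obtain ⟨hb, hk⟩ := ih
    have hu := hunit k hb
    have hδ : (1 - f.jacobian (f.newton k))⁻¹ *ᵥ (f.value (f.newton k) - f.newton k) -
        q.jac (f.newton k) *ᵥ
          ((1 - f.jacobian (f.newton k))⁻¹ *ᵥ (f.value (f.newton k) - f.newton k)) =
        q.value (f.newton k) - f.newton k := by
      rw [← hjac, ← hval]
      nth_rewrite 1 [← one_mulVec (_ *ᵥ (f.value (f.newton k) - f.newton k))]
      rw [← sub_mulVec, mulVec_mulVec, mul_nonsing_inv _ ((isUnit_iff_isUnit_det _).1 hu),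
        one_mulVec]
    refine ⟨hb.step hconn hpos hconst hμ hδ, ?_⟩
    have := hb.step_le hconn hpos hconst hμ hδ hd (by positivity) hk
    rwa [div_div, ← pow_succ] at this

end PolySystem

/-! ### Quadratic polynomials with symmetric coefficient matrices. -/

namespace MvPolynomial

variable {σ : Type*} [Fintype σ]

/-- The polynomial `c + ∑ L_j X_j + ∑ B_jk X_j X_k`. -/
noncomputable def quadratic (c : ℝ) (L : σ → ℝ) (B : Matrix σ σ ℝ) : MvPolynomial σ ℝ :=
  C c + ∑ j, C (L j) * X j + ∑ j, ∑ k, C (B j k) * (X j * X k)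

/-- `p` is a quadratic polynomial with non-negative coefficients. -/
def IsNonnegQuadratic (p : MvPolynomial σ ℝ) : Prop :=
  ∃ (c : ℝ) (L : σ → ℝ) (B : Matrix σ σ ℝ), 0 ≤ c ∧ (∀ j, 0 ≤ L j) ∧ (∀ j k, 0 ≤ B j k) ∧
    (∀ j k, B j k = B k j) ∧ p = quadratic c L B

theorem eval_quadratic (c : ℝ) (L : σ → ℝ) (B : Matrix σ σ ℝ) (x : σ → ℝ) :
    eval x (quadratic c L B) = c + L ⬝ᵥ x + x ⬝ᵥ B *ᵥ x := by
  simp only [quadratic, map_add, map_sum, map_mul, eval_C, eval_X, dotProduct, mulVec,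
    Finset.mul_sum]
  congr 1
  refine Finset.sum_congr rfl fun j _ => Finset.sum_congr rfl fun k _ => ?_
  ring

theorem pderiv_quadratic [DecidableEq σ] (c : ℝ) (L : σ → ℝ) {B : Matrix σ σ ℝ}
    (hB : ∀ j k, B j k = B k j) (i : σ) :
    pderiv i (quadratic c L B) = C (L i) + ∑ k, C (2 * B i k) * X k := by
  have h1 : ∑ j, ∑ k, C (B j k) * (X j * (Pi.single i 1 : σ → MvPolynomial σ ℝ) k) =
      ∑ k, C (B i k) * X k := by
    refine Finset.sum_congr rfl fun j _ => ?_
    rw [Finset.sum_eq_single i (by intro b _ hb; simp [hb]) (by simp)]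
    simp [hB j i]
  have h2 : ∑ j, ∑ k, C (B j k) * (X k * (Pi.single i 1 : σ → MvPolynomial σ ℝ) j) =
      ∑ k, C (B i k) * X k := by
    rw [Finset.sum_eq_single i (by intro b _ hb; simp [hb]) (by simp)]
    simp
  have h3 : ∑ j, C (L j) * (Pi.single i 1 : σ → MvPolynomial σ ℝ) j = C (L i) := by
    rw [Finset.sum_eq_single i (by intro b _ hb; simp [hb]) (by simp)]
    simp
  simp only [quadratic, map_add, map_sum, Derivation.leibniz, pderiv_C, pderiv_X, smul_eq_mul,
    mul_zero, add_zero, zero_add, mul_add, Finset.sum_add_distrib, h1, h2, h3]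
  rw [← Finset.sum_add_distrib]
  congr 1
  refine Finset.sum_congr rfl fun k _ => ?_
  rw [C_mul, show (C (2 : ℝ) : MvPolynomial σ ℝ) = 2 from rfl]
  ring

namespace IsNonnegQuadratic

theorem add {p r : MvPolynomial σ ℝ} (hp : p.IsNonnegQuadratic) (hr : r.IsNonnegQuadratic) :
    (p + r).IsNonnegQuadratic := by
  obtain ⟨c, L, B, hc, hL, hB, hs, rfl⟩ := hp
  obtain ⟨c', L', B', hc', hL', hB', hs', rfl⟩ := hr
  refine ⟨c + c', L + L', B + B', add_nonneg hc hc', fun j => add_nonneg (hL j) (hL' j),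
    fun j k => add_nonneg (hB j k) (hB' j k), fun j k => ?_, ?_⟩
  · simp [hs j k, hs' j k]
  · simp only [quadratic, Pi.add_apply, Matrix.add_apply, C_add, add_mul, Finset.sum_add_distrib]
    abel

theorem C_mul {p : MvPolynomial σ ℝ} (hp : p.IsNonnegQuadratic) {a : ℝ} (ha : 0 ≤ a) :
    (C a * p).IsNonnegQuadratic := by
  obtain ⟨c, L, B, hc, hL, hB, hs, rfl⟩ := hp
  refine ⟨a * c, a • L, a • B, mul_nonneg ha hc, fun j => mul_nonneg ha (hL j),
    fun j k => mul_nonneg ha (hB j k), fun j k => ?_, ?_⟩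
  · simp [hs j k]
  · simp only [quadratic, Pi.smul_apply, Matrix.smul_apply, smul_eq_mul, MvPolynomial.C_mul,
      mul_add, Finset.mul_sum, mul_assoc]

theorem const {a : ℝ} (ha : 0 ≤ a) : (C a : MvPolynomial σ ℝ).IsNonnegQuadratic :=
  ⟨a, 0, 0, ha, fun _ => le_rfl, fun _ _ => le_rfl, fun _ _ => rfl, by simp [quadratic]⟩

theorem sum {ι : Type*} {s : Finset ι} {p : ι → MvPolynomial σ ℝ}
    (h : ∀ i ∈ s, (p i).IsNonnegQuadratic) : (∑ i ∈ s, p i).IsNonnegQuadratic :=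
  Finset.sum_induction p IsNonnegQuadratic (fun _ _ => add)
    (by simpa using const (σ := σ) le_rfl) h

theorem X [DecidableEq σ] (i : σ) : (X i : MvPolynomial σ ℝ).IsNonnegQuadratic := by
  refine ⟨0, Pi.single i 1, 0, le_rfl, fun j => ?_, fun _ _ => le_rfl, fun _ _ => rfl, ?_⟩
  · rcases eq_or_ne j i with rfl | h <;> simp [*]
  · simp only [quadratic, Matrix.zero_apply, C_0, zero_mul, Finset.sum_const_zero, zero_add,
      add_zero]
    rw [Finset.sum_eq_single i (by intro b _ hb; simp [hb]) (by simp)]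
    simp

/-- Symmetry forces the coefficient to be split into two halves; for `i = j` they add up on the
diagonal. -/
theorem X_mul_X [DecidableEq σ] (i j : σ) :
    (MvPolynomial.X i * MvPolynomial.X j : MvPolynomial σ ℝ).IsNonnegQuadratic := by
  refine ⟨0, 0, Matrix.single i j (1 / 2) + Matrix.single j i (1 / 2), le_rfl, fun _ => le_rfl,
    fun a b => ?_, fun a b => ?_, ?_⟩
  · simp only [Matrix.add_apply, Matrix.single_apply]
    positivity
  · simp only [Matrix.add_apply, Matrix.single_apply]
    rw [add_comm]
    congr 1 <;> simp only [and_comm]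
  · have key : ∀ i j : σ, ∑ a, ∑ b, C (Matrix.single i j (1 / 2 : ℝ) a b) *
        (MvPolynomial.X a * MvPolynomial.X b : MvPolynomial σ ℝ) =
        C (1 / 2) * (MvPolynomial.X i * MvPolynomial.X j) := fun i j => by
      rw [Finset.sum_eq_single i ?_ (by simp), Finset.sum_eq_single j ?_ (by simp)]
      · simp
      · intro b _ hb
        simp [hb.symm]
      · intro b _ hb
        simp [hb.symm]
    simp only [quadratic, Matrix.add_apply, C_add, add_mul, Finset.sum_add_distrib, key,
      Pi.zero_apply, C_0, zero_mul, Finset.sum_const_zero, zero_add]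
    rw [mul_comm (MvPolynomial.X j) (MvPolynomial.X i), ← add_mul, ← C_add]
    norm_num

end IsNonnegQuadratic

end MvPolynomial

/-! ### Coefficients, dependence and the size of `c_min`. -/

namespace PolySystem

open MvPolynomial

variable {σ : Type*} [Fintype σ] {f : PolySystem σ}

/-- `f` is the system of polynomials with the coefficients of `q`. -/
def IsGivenBy (f : PolySystem σ) (q : QuadSystem σ) : Prop :=
  ∀ i, f i = quadratic (q.const i) (q.lin i) (q.quad i)

theorem exists_isGivenBy (h : ∀ i, (f i).IsNonnegQuadratic) :
    ∃ q : QuadSystem σ, f.IsGivenBy q := by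
  choose c L B hc hL hB hs hf using h
  exact ⟨⟨c, L, B, hc, hL, hB, hs⟩, hf⟩

namespace IsGivenBy

variable {q : QuadSystem σ}

theorem value_eq (h : f.IsGivenBy q) : f.value = q.value := by
  funext x i
  rw [value, h i, eval_quadratic]
  rfl

theorem jacobian_eq [DecidableEq σ] (h : f.IsGivenBy q) : f.jacobian = q.jac := by
  funext x
  ext i j
  simp only [jacobian, of_apply, h i, pderiv_quadratic _ _ (q.quad_symm i), map_add, map_sum,
    map_mul, eval_C, eval_X, QuadSystem.jac, mulVec, dotProduct, Finset.mul_sum, mul_assoc]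

theorem dep_of_dependsDirectly (h : f.IsGivenBy q) {i j : σ}
    (hij : f.DependsDirectly i j) : q.Dep i j := by
  classical
  by_contra hno
  simp only [QuadSystem.Dep, not_or, not_exists, not_lt] at hno
  refine hij ?_
  rw [h i, pderiv_quadratic _ _ (q.quad_symm i), le_antisymm hno.1 (q.lin_nonneg i j)]
  simp [fun k => le_antisymm (hno.2 k) (q.quad_nonneg i j k)]

theorem coeff_zero (h : f.IsGivenBy q) (i : σ) : (f i).coeff 0 = q.const i := by
  have := congrFun (congrFun h.value_eq 0) i
  rw [QuadSystem.value_zero] at this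
  rw [← this, value, ← constantCoeff_eq, ← eval_zero]

theorem lin_eq_coeff [DecidableEq σ] (h : f.IsGivenBy q) (i j : σ) :
    q.lin i j = (f i).coeff (Finsupp.single j 1) := by
  have := coeff_pderiv (i := j) (f i) 0
  rw [h i, pderiv_quadratic _ _ (q.quad_symm i), ← h i] at this
  simpa [coeff_sum, coeff_C_mul, coeff_zero_X, -C_mul, -map_mul] using this

/-- The last factor is `2` on the diagonal and `1` off it. In both cases `2 * q.quad i j k` is at
least the coefficient of the monomial, hence at least `c_min` when that coefficient is non-zero. -/
theorem quad_eq_coeff [DecidableEq σ] (h : f.IsGivenBy q) (i j k : σ) : 2 * q.quad i j k =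
    (f i).coeff (Finsupp.single k 1 + Finsupp.single j 1) * (Finsupp.single k 1 j + 1 : ℕ) := by
  have := coeff_pderiv (i := j) (f i) (Finsupp.single k 1)
  rw [h i, pderiv_quadratic _ _ (q.quad_symm i), ← h i] at this
  have hk : (0 : σ →₀ ℕ) ≠ Finsupp.single k 1 := (Finsupp.single_ne_zero.2 one_ne_zero).symm
  rw [coeff_add, coeff_sum, Finset.sum_eq_single k] at this
  · simpa [coeff_C, coeff_C_mul, hk, -C_mul, -map_mul] using this
  · intro b _ hb
    simp [coeff_C_mul, coeff_X, Finsupp.single_left_inj, hb, -C_mul, -map_mul]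
  · simp

end IsGivenBy

variable {q : QuadSystem σ}

theorem StronglyConnected.eq_univ {σ : Type*} {f : PolySystem σ} (hf : f.StronglyConnected)
    {S : Set σ} (hS : S.Nonempty) (hcl : ∀ i ∈ S, ∀ j, f.DependsDirectly i j → j ∈ S) :
    S = Set.univ := by
  obtain ⟨i, hi⟩ := hS
  refine Set.eq_univ_of_forall fun k => ?_
  induction hf i k with
  | refl => exact hi
  | tail _ hbc ih => exact hcl _ ih _ hbc

/-- A non-zero ratio has numerator at least `1` and denominator below `2^m`. The witness `hd` is
needed because the infimum of the empty set is `0`. -/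
theorem two_pow_neg_le_cmin {σ : Type*} {f : PolySystem σ} {m : ℕ}
    (hbits : f.HasBitCoeffs m) {i : σ} {d : σ →₀ ℕ} (hd : (f i).coeff d ≠ 0) : ((2 : ℝ) ^ m)⁻¹ ≤ f.cmin := by
  refine le_csInf ⟨_, hd, i, d, rfl⟩ ?_
  rintro _ ⟨hne, i, d, rfl⟩
  obtain ⟨a, b, -, hb0, hb, hab⟩ := hbits i d hne
  have ha0 : a ≠ 0 := by
    rintro rfl
    simp [hab] at hne
  have ha : (1 : ℝ) ≤ a := by exact_mod_cast Nat.one_le_iff_ne_zero.2 ha0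
  have hb0' : (0 : ℝ) < b := by exact_mod_cast hb0
  have hb' : (b : ℝ) ≤ 2 ^ m := by exact_mod_cast hb.le
  rw [hab, ← one_div]
  exact div_le_div₀ (by positivity) ha hb0' hb'

namespace IsGivenBy

theorem coeff_nonneg (h : f.IsGivenBy q) (i : σ) (d : σ →₀ ℕ) : 0 ≤ (f i).coeff d := by
  classical
  rw [h i, quadratic]
  simp only [coeff_add, coeff_sum, coeff_C_mul]
  refine add_nonneg (add_nonneg ?_ (Finset.sum_nonneg fun j _ => mul_nonneg (q.lin_nonneg i j) ?_))
    (Finset.sum_nonneg fun j _ => Finset.sum_nonneg fun k _ => mul_nonneg (q.quad_nonneg i j k) ?_)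
  · rw [coeff_C]
    split_ifs
    exacts [q.const_nonneg i, le_rfl]
  · rw [coeff_X]
    split_ifs <;> norm_num
  · rw [coeff_mul]
    refine Finset.sum_nonneg fun _ _ => mul_nonneg ?_ ?_ <;>
    · rw [coeff_X]
      split_ifs <;> norm_num

theorem cmin_le_coeff (h : f.IsGivenBy q) {i : σ} {d : σ →₀ ℕ} (hd : (f i).coeff d ≠ 0) :
    f.cmin ≤ (f i).coeff d :=
  csInf_le ⟨0, by rintro _ ⟨-, i, d, rfl⟩; exact h.coeff_nonneg i d⟩ ⟨hd, i, d, rfl⟩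

theorem cmin_le_const (h : f.IsGivenBy q) {i : σ} (hi : 0 < q.const i) :
    f.cmin ≤ q.const i := by
  rw [← h.coeff_zero] at hi ⊢
  exact h.cmin_le_coeff hi.ne'

/-- Along a dependence, the entry of the Jacobian at `μ` is at least `c_min · min {μ_min, 1}`. -/
theorem cmin_mul_le_jac (h : f.IsGivenBy q) (hc : 0 ≤ f.cmin) {μ : σ → ℝ} {w : ℝ} (hw : 0 ≤ w)
    (hμ : ∀ i, w ≤ μ i) {i j : σ} (hij : q.Dep i j) : f.cmin * min w 1 ≤ q.jac μ i j := by
  classical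
  have hμ0 : ∀ i, 0 ≤ μ i := fun i => hw.trans (hμ i)
  have hm := mulVec_nonneg_of_nonneg (q.quad_nonneg i) hμ0
  rcases hij with hl | ⟨k, hk⟩
  · have h1 : f.cmin ≤ q.lin i j := by
      rw [h.lin_eq_coeff] at hl ⊢
      exact h.cmin_le_coeff hl.ne'
    have h2 : f.cmin * min w 1 ≤ f.cmin := mul_le_of_le_one_right hc (min_le_right _ _)
    have h3 := hm j
    simp only [QuadSystem.jac, of_apply, Pi.zero_apply] at h3 ⊢
    linarith
  · have h1 : f.cmin ≤ 2 * q.quad i j k := by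
      have hq := h.quad_eq_coeff i j k
      have hne : (f i).coeff (Finsupp.single k 1 + Finsupp.single j 1) ≠ 0 := by
        intro h0
        rw [h0, zero_mul] at hq
        linarith
      rw [hq]
      refine (h.cmin_le_coeff hne).trans (le_mul_of_one_le_right (h.coeff_nonneg _ _) ?_)
      exact_mod_cast Nat.succ_le_succ (Nat.zero_le _)
    have h2 : q.quad i j k * μ k ≤ (q.quad i *ᵥ μ) j :=
      Finset.single_le_sum (f := fun k => q.quad i j k * μ k)
        (fun l _ => mul_nonneg (q.quad_nonneg i j l) (hμ0 l)) (Finset.mem_univ k)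
    have h3 : f.cmin * min w 1 ≤ 2 * q.quad i j k * μ k :=
      mul_le_mul h1 ((min_le_left _ _).trans (hμ k)) (le_min hw zero_le_one) (hc.trans h1)
    have h4 := q.lin_nonneg i j
    simp only [QuadSystem.jac, of_apply]
    linarith

end IsGivenBy

/-- The convergence threshold of Newton's method, for strongly connected quadratic systems with
positive constant terms whose Kleene iterates are bounded by `1`. -/
theorem IsGivenBy.newton_hasValidBits [DecidableEq σ] [Nonempty σ] (h : f.IsGivenBy q)
    (hconn : f.StronglyConnected) (hconst : ∀ i, 0 < q.const i) (hb : ∀ k, q.kleene k ≤ 1)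
    {m : ℕ} (hbits : f.HasBitCoeffs m) :
    ∃ μ : σ → ℝ, f.IsLeastFixedPoint μ ∧ (∀ i, 0 < μ i) ∧
      f.threshold μ ≤ 3 * (Fintype.card σ : ℝ) * (m : ℝ) ∧ f.NewtonDefined ∧
      ∀ i : ℕ, HasValidBits μ (f.newton (⌈f.threshold μ⌉₊ + i)) i := by
  have hconn' : ∀ S : Set σ, S.Nonempty → (∀ i ∈ S, ∀ j, q.Dep i j → j ∈ S) → S = Set.univ :=
    fun S hS hcl => hconn.eq_univ hS fun i hi j hij => hcl i hi j (h.dep_of_dependsDirectly hij)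
  obtain ⟨μ, hlim, hμ0, hμ1, hμ, hleast⟩ := q.exists_tendsto_kleene hb
  have hcμ : ∀ i, q.const i ≤ μ i := fun i => by
    have := q.value_mono le_rfl hμ0 i
    rwa [hμ, QuadSystem.value_zero] at this
  have hpos : ∀ i, 0 < μ i := fun i => (hconst i).trans_le (hcμ i)
  obtain ⟨a, ha⟩ := exists_eq_ciInf_of_finite (f := μ)
  obtain ⟨b, hbM⟩ := exists_eq_ciSup_of_finite (f := μ)
  set w := ⨅ i, μ i with hw
  set M := ⨆ i, μ i with hM
  have hwμ : ∀ i, w ≤ μ i := fun i => ciInf_le (Set.finite_range μ).bddBelow i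
  have hμM : ∀ i, μ i ≤ M := fun i => le_ciSup (Set.finite_range μ).bddAbove i
  have hw0 : 0 < w := ha ▸ hpos a
  have hM1 : M ≤ 1 := hbM ▸ hμ1 b
  have hwM : w ≤ M := (hwμ b).trans (hμM b)
  have hM0 : 0 < M := hw0.trans_le hwM
  have hcm : ((2 : ℝ) ^ m)⁻¹ ≤ f.cmin :=
    two_pow_neg_le_cmin hbits (i := a) (d := 0)
      (by rw [h.coeff_zero]; exact (hconst a).ne')
  have hc0 : 0 < f.cmin := lt_of_lt_of_le (by positivity) hcm
  have hcw : f.cmin ≤ w := ha ▸ (h.cmin_le_const (hconst a)).trans (hcμ a)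
  set γ := f.cmin * min w 1 with hγ
  have hw1 : min w 1 = w := min_eq_left (hwM.trans hM1)
  have hγ0 : 0 < γ := mul_pos hc0 (lt_min hw0 one_pos)
  have hγ1 : γ ≤ 1 :=
    mul_le_one₀ (hcw.trans (hwM.trans hM1)) (lt_min hw0 one_pos).le (min_le_right _ _)
  obtain ⟨d, hd0, hdne, hjd⟩ := q.exists_nonneg_jac_mulVec_le hlim
    (q.kleene_le hμ0 hμ.le) (fun h0 => (hpos a).ne' (congrFun h0 a)) hμ
  have hdpos := QuadSystem.pos_of_jac_mulVec_le hconn' hpos hd0 hdne hjd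
  have hdep : ∀ i j, q.Dep i j → γ * d j ≤ d i := fun i j hij => by
    refine le_trans ?_ (hjd i)
    refine le_trans (mul_le_mul_of_nonneg_right
      (h.cmin_mul_le_jac hc0.le hw0.le hwμ hij) (hd0 j)) ?_
    exact Finset.single_le_sum (f := fun j => q.jac μ i j * d j)
      (fun k _ => mul_nonneg (q.jac_nonneg hμ0 i k) (hd0 k)) (Finset.mem_univ j)
  obtain ⟨l, -, hl⟩ := Finset.exists_max_image Finset.univ d ⟨a, Finset.mem_univ a⟩
  set n := Fintype.card σ with hn
  have hn0 : n ≠ 0 := Fintype.card_ne_zero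
  have hγn : 0 < γ ^ n := pow_pos hγ0 n
  have hlow := fun i => QuadSystem.pow_mul_le_of_dep hconn' hγ0.le hγ1 hd0 hdep i l
  -- Since `γ ^ n * d l ≤ d i` for all `i`, this `r` gives `μ i ≤ M ≤ r * d i`, the starting bound
  -- at `ν⁽⁰⁾ = 0`.
  set r := M / (γ ^ n * d l) with hr
  have hr0 : 0 < r := div_pos hM0 (mul_pos hγn (hdpos l))
  have hrd : μ ≤ r • d := fun i => by
    refine (hμM i).trans ?_
    calc M = r * (γ ^ n * d l) := (div_mul_cancel₀ _ (mul_pos hγn (hdpos l)).ne').symm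
      _ ≤ r * d i := mul_le_mul_of_nonneg_left (hlow i) hr0.le
  have hnewton := newton_below h.value_eq h.jacobian_eq hconn' hpos hconst hμ hjd hr0.le hrd
  set R := M / (f.cmin * w * min w 1) with hR
  have hR0 : 0 < R := by
    rw [hR, hw1]
    positivity
  have hthr : f.threshold μ = n * Real.logb 2 R := rfl
  refine ⟨μ, ⟨⟨hμ0, h.value_eq ▸ hμ⟩, fun x hx => hleast x hx.1 (h.value_eq ▸ hx.2)⟩, hpos, ?_,
    fun k => (hnewton k).1, fun i j => ?_⟩
  -- One factor `2^m` comes from `c_min` and two from `w`, as `min w 1 = w`.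
  · have hle : R ≤ 2 ^ (3 * m) := by
      rw [hR, hw1, div_le_iff₀ (by positivity)]
      refine hM1.trans ?_
      have h1 : ((2 : ℝ) ^ m)⁻¹ * (2 ^ m)⁻¹ * (2 ^ m)⁻¹ ≤ f.cmin * w * w := by
        have h2 := hcm.trans hcw
        gcongr
      calc (1 : ℝ) = 2 ^ (3 * m) * (((2 : ℝ) ^ m)⁻¹ * (2 ^ m)⁻¹ * (2 ^ m)⁻¹) := by
            rw [mul_comm 3 m, pow_mul]
            field_simp
        _ ≤ _ := by gcongr
    have hlog : Real.logb 2 R ≤ 3 * m := by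
      rw [Real.logb_le_iff_le_rpow one_lt_two hR0]
      exact_mod_cast hle
    rw [hthr]
    calc (n : ℝ) * Real.logb 2 R ≤ n * (3 * m) := by gcongr
      _ = 3 * n * m := by ring
  · set K := ⌈f.threshold μ⌉₊ with hK
    have hK2 : R ^ n ≤ 2 ^ K := by
      have h1 : (n : ℝ) * Real.logb 2 R ≤ K := hthr ▸ Nat.le_ceil _
      rw [← Real.logb_pow, Real.logb_le_iff_le_rpow one_lt_two (by positivity)] at h1
      exact_mod_cast h1
    -- The error estimate costs a single factor `M / w`, whereas `R ^ n` contains `n` of them; this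
    -- is harmless because `M / w ≥ 1` and `n ≥ 1`.
    have hRn : M / w / γ ^ n ≤ R ^ n := by
      have h1 : R = M / w / γ := by
        rw [hR, hγ, div_div]
        congr 1
        ring
      rw [h1, div_pow]
      gcongr
      exact le_self_pow₀ ((one_le_div hw0).2 hwM) hn0
    obtain ⟨-, hbelow, herr⟩ := hnewton (K + i)
    have herr := herr j
    have h0 : 0 ≤ μ j - f.newton (K + i) j := sub_nonneg.2 (hbelow.le j)
    rw [abs_of_nonneg h0, abs_of_pos (hpos j), div_le_iff₀ (hpos j)]
    refine herr.trans ?_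
    have hMK : M / γ ^ n ≤ w * 2 ^ K := by
      have := hRn.trans hK2
      rw [div_right_comm, div_le_iff₀ hw0] at this
      linarith
    calc r / 2 ^ (K + i) * d j ≤ r / 2 ^ (K + i) * d l := by
          have := hl j (Finset.mem_univ j)
          gcongr
      _ = M / γ ^ n / 2 ^ (K + i) := by
          have := (hdpos l).ne'
          rw [hr]
          field_simp
      _ ≤ w * 2 ^ K / 2 ^ (K + i) := by gcongr
      _ = (1 / 2) ^ i * w := by
          rw [pow_add, one_div, inv_pow]
          field_simp
      _ ≤ (1 / 2) ^ i * μ j := by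
          have := hwμ j
          gcongr

end PolySystem

/-! ### Termination systems of pPDA. -/

namespace PPDA

open MvPolynomial

variable {Q Γ : Type*} [Fintype Q] [DecidableEq Q]


theorem termMonomials_isNonnegQuadratic [Fintype Γ] (q r : Q) (α : List Γ) :
    (termMonomials q r α).IsNonnegQuadratic := by
  classical
  match α with
  | [] =>
    rw [termMonomials]
    split_ifs
    · simpa using IsNonnegQuadratic.const zero_le_one
    · simpa using IsNonnegQuadratic.const le_rfl
  | [Y] => exact IsNonnegQuadratic.X _
  | [Y, Z] => exact IsNonnegQuadratic.sum fun t _ => IsNonnegQuadratic.X_mul_X _ _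
  | _ :: _ :: _ :: _ =>
    rw [termMonomials]
    · simpa using IsNonnegQuadratic.const le_rfl
    all_goals simp

theorem terminationSystem_isNonnegQuadratic [Fintype Γ] (P : PPDA Q Γ) (v : Q × Γ × Q) :
    (P.terminationSystem v).IsNonnegQuadratic :=
  IsNonnegQuadratic.sum fun r hr =>
    (termMonomials_isNonnegQuadratic _ _ _).C_mul (P.prob_pos _ _ r hr).le

/-- If the numbers `x_{pXq}` are sub-probabilities, then the termination of `rα` in any control
state also has at most probability `1`. -/
theorem sum_eval_termMonomials_le {x : Q × Γ × Q → ℝ} (hx : 0 ≤ x)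
    (hsum : ∀ p X, ∑ q, x (p, X, q) ≤ 1) (r : Q) (α : List Γ) :
    ∑ q, eval x (termMonomials q r α) ≤ 1 := by
  match α with
  | [] => simp [termMonomials, apply_ite (eval x)]
  | [Y] => simpa [termMonomials] using hsum r Y
  | [Y, Z] =>
    simp only [termMonomials, map_sum, map_mul, eval_X]
    rw [Finset.sum_comm]
    simp only [← Finset.mul_sum]
    exact (Finset.sum_le_sum fun t _ => mul_le_of_le_one_right (hx (r, Y, t)) (hsum t Z)).trans
      (hsum r Y)
  | _ :: _ :: _ :: _ => simp [termMonomials]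

/-- The value is a convex combination, over the transitions of `pX`, of sums that are at most `1`.
By induction from `0` this bounds all Kleene iterates. -/
theorem sum_value_terminationSystem_le (P : PPDA Q Γ) {x : Q × Γ × Q → ℝ} (hx : 0 ≤ x)
    (hsum : ∀ p X, ∑ q, x (p, X, q) ≤ 1) (p : Q) (X : Γ) :
    ∑ q, P.terminationSystem.value x (p, X, q) ≤ 1 := by
  simp only [PolySystem.value, terminationSystem, map_sum, map_mul, eval_C]
  rw [Finset.sum_comm, ← P.sum_prob p X]
  refine Finset.sum_le_sum fun r hr => ?_
  rw [← Finset.mul_sum]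
  exact mul_le_of_le_one_right (P.prob_pos p X r hr).le (sum_eval_termMonomials_le hx hsum _ _)

theorem Strict.value_zero_pos {P : PPDA Q Γ} (hP : P.Strict) (v : Q × Γ × Q) :
    0 < P.terminationSystem.value 0 v := by
  obtain ⟨p, X, q⟩ := v
  have hmem := hP p X q
  simp only [PolySystem.value, terminationSystem, map_sum, map_mul, eval_C]
  refine Finset.sum_pos' (fun r hr => mul_nonneg (P.prob_pos p X r hr).le ?_)
    ⟨_, hmem, mul_pos (P.prob_pos p X _ hmem) (by simp [termMonomials])⟩
  match r.2 with
  | [] =>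
    rw [termMonomials]
    split_ifs <;> simp
  | [_] => simp [termMonomials]
  | [_, _] => simp [termMonomials]
  | _ :: _ :: _ :: _ => simp [termMonomials]

end PPDA

theorem proposition4p3 {Q Γ : Type*} [Fintype Q] [DecidableEq Q] [Fintype Γ] [DecidableEq Γ]
    (P : PPDA Q Γ) (hstrict : P.Strict)
    (hconn : P.terminationSystem.StronglyConnected)
    (m : ℕ) (hbits : P.terminationSystem.HasBitCoeffs m) :
    ∃ μ : Q × Γ × Q → ℝ,
      P.terminationSystem.IsLeastFixedPoint μ ∧ (∀ v, 0 < μ v) ∧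
      P.terminationSystem.threshold μ ≤ 3 * (Fintype.card (Q × Γ × Q) : ℝ) * (m : ℝ) ∧
      P.terminationSystem.NewtonDefined ∧
      ∀ i : ℕ, HasValidBits μ
        (P.terminationSystem.newton (⌈P.terminationSystem.threshold μ⌉₊ + i)) i := by
  rcases isEmpty_or_nonempty (Q × Γ × Q) with hempty | hne
  · refine ⟨0, ⟨⟨le_rfl, Subsingleton.elim _ _⟩, fun x _ => (Subsingleton.elim 0 x).le⟩,
      fun v => hempty.elim v, ?_, fun k => ?_, fun i v => hempty.elim v⟩
    · simp [PolySystem.threshold, Fintype.card_eq_zero]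
    · rw [Subsingleton.elim (1 - _) (1 : Matrix (Q × Γ × Q) (Q × Γ × Q) ℝ)]
      exact isUnit_one
  · obtain ⟨q, hq⟩ := PolySystem.exists_isGivenBy P.terminationSystem_isNonnegQuadratic
    refine hq.newton_hasValidBits hconn (fun v => ?_) (fun k => ?_) hbits
    · rw [← q.value_zero, ← hq.value_eq]
      exact hstrict.value_zero_pos v
    · have hsum : ∀ k p X, ∑ r, q.kleene k (p, X, r) ≤ 1 := fun k => by
        induction k with
        | zero => simp [QuadSystem.kleene]
        | succ k ih =>
          intro p X
          rw [q.kleene_succ, ← hq.value_eq]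
          exact P.sum_value_terminationSystem_le (q.kleene_nonneg k) ih p X
      rintro ⟨p, X, r⟩
      exact (Finset.single_le_sum (f := fun r => q.kleene k (p, X, r))
        (fun r _ => q.kleene_nonneg k _) (Finset.mem_univ r)).trans (hsum k p X)
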